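/- Let $K$ be a (commutative) field. A dendriform algebra over $K$ is a $K$-vector space $A$ with two bilinear products $\prec,\succ$ such that for all $x,y,z\in A$: $(x\prec y)\prec z=x\prec(y\prec z+y\succ z)$, $(x\succ y)\prec z=x\succ(y\prec z)$, $(x\prec y+x\succ y)\succ z=x\succ(y\succ z)$. It is free if there is a subset $X\subseteq A$ such that every map from $X$ to a dendriform algebra $B$ over $K$ extends uniquely to a linear map $A\to B$ compatible with $\prec$ and $\succ$. A packed word is a word $w=w(1)\ldots w(n)$ in positive integers whose set of letters is $\{1,\ldots,\max(w)\}$. For any word $x$ in positive integers, $Pack(x)$ is the packed word obtained by replacing each letter by its rank in the set of letters of $x$. For a nonempty packed word $w$ of length $n$, let $m(w)=\max\{i\in[n]\mid w(i)=1\}$ and $M(w)=\max\{i\in[n]\mid w(i)=\max(w)\}$. Let $\mathbf{WQSym}_+$ be the augmentation ideal of $\mathbf{WQSym}$, that is, the $K$-vector space with basis the nonempty packed words. For packed words $u,v$ of lengths $k,l\geq 1$, define four bilinear products $u\nwarrow v$, $u\nearrow v$, $u\swarrow v$, $u\searrow v$, each as the sum of all packed words $w$ of length $k+l$ such that $Pack(w(1)\ldots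 w(k))=u$, $Pack(w(k+1)\ldots w(k+l))=v$, and, respectively, - for $\nwarrow$: $m(w),M(w)\leq k$; - for $\nearrow$: $m(w)\leq k<M(w)$; - for $\swarrow$: $M(w)\leq k<m(w)$; - for $\searrow$: $k<m(w),M(w)$. Put $\leftarrow\,=\,\nwarrow+\swarrow$, $\rightarrow\,=\,\nearrow+\searrow$, $\uparrow\,=\,\nwarrow+\nearrow$, $\downarrow\,=\,\swarrow+\searrow$. **Corollary.** With $(\prec,\succ)=(\leftarrow,\rightarrow)$, and also with $(\prec,\succ)=(\uparrow,\downarrow)$, the space $\mathbf{WQSym}_+$ is a free dendriform algebra over $K$. -/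

import Mathlib

universe u v w

/-! ### Free dendriform algebras -/

section Dendriform

variable {K : Type u} [CommSemiring K] {A : Type v} [AddCommMonoid A] [Module K A]

/-- The three axioms of a dendriform algebra, for two bilinear products
`p` (written `≺`) and `s` (written `≻`) on a `K`-module `A`. -/
structure IsDendriform (p s : A →ₗ[K] A →ₗ[K] A) : Prop where
  prec_prec : ∀ x y z : A, p (p x y) z = p x (p y z + s y z)
  succ_prec : ∀ x y z : A, p (s x y) z = s x (p y z)
  succ_succ : ∀ x y z : A, s (p x y + s x y) z = s x (s y z)

end Dendriform

/-- The dendriform algebra `(A, ≺, ≻)` (with `≺ = p`, `≻ = s`) is free on the subset `X`: every map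
from `X` to a dendriform algebra `B` extends uniquely to a morphism of dendriform algebras
`A → B`. The universe of `B` is arbitrary above those of `K` and `A`. -/
def IsFreeDendriformOn {K : Type u} [Field K] {A : Type v} [AddCommGroup A] [Module K A]
    (p s : A →ₗ[K] A →ₗ[K] A) (X : Set A) : Prop :=
  ∀ (B : Type (max u v w)) [AddCommGroup B] [Module K B] (p' s' : B →ₗ[K] B →ₗ[K] B),
    IsDendriform p' s' → ∀ f : X → B,
      ∃! φ : A →ₗ[K] B,
        (∀ x y : A, φ (p x y) = p' (φ x) (φ y)) ∧
        (∀ x y : A, φ (s x y) = s' (φ x) (φ y)) ∧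
        ∀ x : X, φ (x : A) = f x

/-- `(A, ≺, ≻)` (with `≺ = p`, `≻ = s`) is a dendriform algebra, and it is free on some subset. -/
def IsFreeDendriform {K : Type u} [Field K] {A : Type v} [AddCommGroup A] [Module K A]
    (p s : A →ₗ[K] A →ₗ[K] A) : Prop :=
  IsDendriform p s ∧ ∃ X : Set A, IsFreeDendriformOn.{u, v, w} p s X

/-! ### Packed words -/

/-- The largest letter of a word (`0` for the empty word). -/
def maxLetter (x : List ℕ) : ℕ := x.toFinset.sup id

/-- A word is packed if its set of letters is `{1, …, max}`. -/
def IsPacked (x : List ℕ) : Prop := x.toFinset = Finset.Icc 1 (maxLetter x)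

/-- Nonempty packed words. -/
abbrev PackedWord : Type := {x : List ℕ // x ≠ [] ∧ IsPacked x}

/-- The packing of a word: every letter is replaced by its rank in the set of letters of
the word, the smallest letter having rank `1`. -/
def pack (x : List ℕ) : List ℕ :=
  x.map fun a => (x.toFinset.filter (· ≤ a)).card

/-- The largest position `i ∈ {1, …, n}` with `x(i) = a`, for a word `x` of length `n` in which
the letter `a` occurs. -/
def lastPos (a : ℕ) (x : List ℕ) : ℕ :=
  ((Finset.Icc 1 x.length).filter fun i => x[i - 1]? = some a).sup id

/-- `m(x) = max {i | x(i) = 1}`. -/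
def PackedWord.m (x : PackedWord) : ℕ := lastPos 1 x.1

/-- `M(x) = max {i | x(i) = max(x)}`. -/
def PackedWord.M (x : PackedWord) : ℕ := lastPos (maxLetter x.1) x.1

/-- The packed words `x = x(1) … x(k + l)` with `Pack(x(1) … x(k)) = a` and
`Pack(x(k + 1) … x(k + l)) = b`, where `k` and `l` are the lengths of `a` and `b`. -/
def convolutionSet (a b : PackedWord) : Set PackedWord :=
  {x | x.1.length = a.1.length + b.1.length ∧
    pack (x.1.take a.1.length) = a.1 ∧ pack (x.1.drop a.1.length) = b.1}

theorem PackedWord.le_length (x : PackedWord) {c : ℕ} (hc : c ∈ x.1) : c ≤ x.1.length := by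
  have h1 : c ≤ maxLetter x.1 := Finset.le_sup (f := id) (List.mem_toFinset.2 hc)
  have h2 : maxLetter x.1 = x.1.toFinset.card := by
    rw [show x.1.toFinset = Finset.Icc 1 (maxLetter x.1) from x.2.2]
    simp
  have h3 := x.1.toFinset_card_le
  omega

theorem convolutionSet_finite (a b : PackedWord) : (convolutionSet a b).Finite := by
  set n := a.1.length + b.1.length with hn
  have hfin : (Set.range fun f : Fin n → Fin (n + 1) =>
      List.ofFn fun i => (f i : ℕ)).Finite := Set.finite_range _
  refine Set.Finite.of_finite_image (f := Subtype.val) (hfin.subset ?_)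
    Subtype.val_injective.injOn
  rintro _ ⟨x, ⟨hx, -⟩, rfl⟩
  have hx' : x.1.length = n := hx
  refine ⟨fun i => ⟨x.1[(i : ℕ)]'(by omega), ?_⟩, ?_⟩
  · have := x.le_length (List.getElem_mem (l := x.1) (n := (i : ℕ)) (by omega))
    omega
  · apply List.ext_getElem
    · simp [hx']
    · intro i h1 h2
      simp

/-- The finite set of packed words occurring in the product of `a` and `b`. -/
noncomputable def convolution (a b : PackedWord) : Finset PackedWord :=
  (convolutionSet_finite a b).toFinset

/-! ### The augmentation ideal of WQSym and its products -/

/-- The augmentation ideal of `WQSym` over `K`: the vector space with basis the nonempty packed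
words. -/
abbrev WQSymPlus (K : Type u) [Field K] : Type u := PackedWord →₀ K

namespace WQSymPlus

variable (K : Type u) [Field K]

/-- The bilinear product on `WQSymPlus K` sending two packed words `a`, `b`, with `a` of length
`k`, to the sum of the words `x` in their convolution such that `C k x`. -/
noncomputable def product (C : ℕ → PackedWord → Prop) :
    WQSymPlus K →ₗ[K] WQSymPlus K →ₗ[K] WQSymPlus K :=
  open scoped Classical in
  Finsupp.linearCombination K fun a : PackedWord =>
    Finsupp.linearCombination K fun b : PackedWord =>
      ∑ x ∈ (convolution a b).filter (C a.1.length), Finsupp.single x (1 : K)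

/-- The product `↖`. -/
noncomputable def nw : WQSymPlus K →ₗ[K] WQSymPlus K →ₗ[K] WQSymPlus K :=
  product K fun k x => x.m ≤ k ∧ x.M ≤ k

/-- The product `↗`. -/
noncomputable def ne : WQSymPlus K →ₗ[K] WQSymPlus K →ₗ[K] WQSymPlus K :=
  product K fun k x => x.m ≤ k ∧ k < x.M

/-- The product `↙`. -/
noncomputable def sw : WQSymPlus K →ₗ[K] WQSymPlus K →ₗ[K] WQSymPlus K :=
  product K fun k x => x.M ≤ k ∧ k < x.m

/-- The product `↘`. -/
noncomputable def se : WQSymPlus K →ₗ[K] WQSymPlus K →ₗ[K] WQSymPlus K :=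
  product K fun k x => k < x.m ∧ k < x.M

/-- The product `← = ↖ + ↙`. -/
noncomputable def left : WQSymPlus K →ₗ[K] WQSymPlus K →ₗ[K] WQSymPlus K := nw K + sw K

/-- The product `→ = ↗ + ↘`. -/
noncomputable def right : WQSymPlus K →ₗ[K] WQSymPlus K →ₗ[K] WQSymPlus K := ne K + se K

/-- The product `↑ = ↖ + ↗`. -/
noncomputable def up : WQSymPlus K →ₗ[K] WQSymPlus K →ₗ[K] WQSymPlus K := nw K + ne K

/-- The product `↓ = ↙ + ↘`. -/
noncomputable def down : WQSymPlus K →ₗ[K] WQSymPlus K →ₗ[K] WQSymPlus K := sw K + se K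

end WQSymPlus

/-! A free dendriform algebra on `X` behaves like planar binary trees with nodes labelled by `X`: it
has a basis of elements `l ≻ x ≺ r`, where `l` and `r` are basis elements or absent. Conversely,
suppose that a dendriform algebra has a graded basis `W` in bijection with triples `(l, x, r)`, and
that each `l ≻ x ≺ r` is the corresponding basis element plus terms of the same degree that come
earlier for some statistic. Then a morphism can be built and shown unique by recursion on degree and
statistic. This is `isFreeDendriformOn_of_triangular`.

For `←` and `→`, the condition on `M` only says whether the largest letter of the left factor
exceeds every letter of the right one. The dendriform axioms become comparisons of three maxima. The
element `l ≻ x ≺ r` is then the sum of the words `L M R` with blocks packing to `l`, `x`, `r`, such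
that `max R < max M` and `max L ≤ max (M R)`. Exactly one of these words is layered: `L` at the
bottom, then `M` without its maximum, then `R`, then the maximum of `M`. It has strictly more
ascents than all the others (`Layered.ascents_lt_or`), which gives unitriangularity. Every word has
a unique layered factorization with irreducible middle block (`exists_layerIrreducible`,
`layered_unique`), which gives the bijection with triples; the free generators are the irreducible
packed words.

For `↑` and `↓`, reversing the order of the letters exchanges `m` and `M`, so it carries the first
structure to the second. -/

section Criterion

variable {K : Type u} [CommSemiring K] {A : Type v} [AddCommMonoid A] [Module K A]

/-- The product `a ≺ b`, where the missing right operand stands for a unit. -/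
def precOpt (p : A →ₗ[K] A →ₗ[K] A) (a : A) (b : Option A) : A := b.elim a fun b => p a b

/-- The product `a ≻ b`, where the missing left operand stands for a unit. -/
def succOpt (s : A →ₗ[K] A →ₗ[K] A) (a : Option A) (b : A) : A := a.elim b fun a => s a b

theorem IsDendriform.prec_succOpt {p s : A →ₗ[K] A →ₗ[K] A} (h : IsDendriform p s)
    (a : Option A) (b c : A) : p (succOpt s a b) c = succOpt s a (p b c) := by
  cases a with
  | none => rfl
  | some a => exact h.succ_prec a b c

end Criterion

/-! ### Freeness from a unitriangular basis, and its transport by isomorphism -/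

section Free

open Finsupp

variable {K : Type u} [Field K] {W : Type v}
  {B : Type w} [AddCommGroup B] [Module K B]

theorem single_eq_smul_single (w : W) (k : K) : single w k = k • single w 1 := by simp

/-- The element `l ≻ x ≺ r` attached to basis elements, where `l` and `r` may be missing. -/
noncomputable def tripleProd (p s : (W →₀ K) →ₗ[K] (W →₀ K) →ₗ[K] (W →₀ K))
    (l : Option W) (x : W) (r : Option W) : W →₀ K :=
  succOpt s (l.map fun a => single a 1) (precOpt p (single x 1) (r.map fun a => single a 1))

/-- A family prescribed by triangular recursion along an enumeration of triples. -/
theorem exists_triangular_recursion {X : Set W} (deg c : W → ℕ)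
    (e : Option W × X × Option W ≃ W)
    (hl : ∀ l x r, deg l < deg (e (some l, x, r))) (hr : ∀ l x r, deg r < deg (e (l, x, some r)))
    (E : W → W →₀ K) (hE : ∀ w, ∀ w' ∈ (E w).support, deg w' = deg w ∧ c w' < c w)
    (p' s' : B →ₗ[K] B →ₗ[K] B) (f : X → B) :
    ∃ g : W → B, ∀ l x r, g (e (l, x, r)) =
      succOpt s' (l.map g) (precOpt p' (f x) (r.map g)) -
        linearCombination K g (E (e (l, x, r))) := by
  classical
  let R : W → W → Prop := fun a b => toLex (deg a, c a) < toLex (deg b, c b)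
  have hR : WellFounded R := InvImage.wf (fun w => toLex (deg w, c w)) wellFounded_lt
  have R_iff : ∀ a b, R a b ↔ deg a < deg b ∨ deg a = deg b ∧ c a < c b :=
    fun a b => Prod.Lex.toLex_lt_toLex
  let G : W → (W → B) → B := fun w g =>
    succOpt s' ((e.symm w).1.map g) (precOpt p' (f (e.symm w).2.1) ((e.symm w).2.2.map g)) -
        linearCombination K g (E w)
  -- The default 0 is never read: `G` evaluates its argument only at `l` and `r`, of smaller degree,
  -- and on the support of `E w`, of equal degree and smaller `c`.
  let g : W → B := hR.fix fun w rec => G w fun w' => if h : R w' w then rec w' h else 0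
  refine ⟨g, fun l x r => ?_⟩
  have h1 : g (e (l, x, r)) =
      G (e (l, x, r)) (fun w' => if R w' (e (l, x, r)) then g w' else 0) := by
    have := hR.fix_eq (fun w rec => G w fun w' => if h : R w' w then rec w' h else 0)
      (e (l, x, r))
    simpa [g] using this
  rw [h1]
  simp only [G, Equiv.symm_apply_apply]
  congr 1
  · congr 1
    · cases l with
      | none => rfl
      | some l => simp [R_iff, hl l x r]
    · congr 1
      cases r with
      | none => rfl
      | some r => simp [R_iff, hr l x r]
  · rw [linearCombination_apply, linearCombination_apply]
    refine Finsupp.sum_congr fun w hw => ?_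
    rw [if_pos ((R_iff _ _).2 (Or.inr (hE _ w hw)))]

/-- A dendriform algebra with a basis such that the elements `l ≻ x ≺ r` are unitriangular
is free. -/
theorem isFreeDendriformOn_of_triangular
    {p s : (W →₀ K) →ₗ[K] (W →₀ K) →ₗ[K] (W →₀ K)} (h : IsDendriform p s)
    {X : Set W} (deg c : W → ℕ) (e : Option W × X × Option W ≃ W)
    (hl : ∀ l x r, deg l < deg (e (some l, x, r))) (hr : ∀ l x r, deg r < deg (e (l, x, some r)))
    (htri : ∀ l x r, ∀ w ∈ (tripleProd p s l x r - single (e (l, x, r)) 1).support,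
      deg w = deg (e (l, x, r)) ∧ c w < c (e (l, x, r))) :
    IsFreeDendriformOn.{u, max v u, w} p s ((fun x => single x (1 : K)) '' X) := by
  intro B _ _ p' s' h' f₀
  let f : X → B := fun x => f₀ ⟨single x.1 1, x.1, x.2, rfl⟩
  let E : W → W →₀ K := fun w =>
    tripleProd p s (e.symm w).1 (e.symm w).2.1 (e.symm w).2.2 - single w 1
  have hE : ∀ w, ∀ w' ∈ (E w).support, deg w' = deg w ∧ c w' < c w := by
    intro w
    obtain ⟨⟨l, x, r⟩, rfl⟩ := e.surjective w
    simpa [E] using htri l x r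
  have hEe : ∀ l (x : X) r, tripleProd p s l x r = single (e (l, x, r)) 1 + E (e (l, x, r)) := by
    intro l x r
    simp [E]
  -- induction principle on basis elements
  have ind : ∀ (n : ℕ) (P : (W →₀ K) → Prop),
      (∀ a b, P a → P b → P (a + b)) → (∀ (k : K) a, P a → P (k • a)) →
      (∀ l x r, deg (e (l, x, r)) = n → P (tripleProd p s l x r)) →
      ∀ w, deg w = n → P (single w 1) := by
    intro n P hadd hsmul hT
    have key : ∀ m w, c w = m → deg w = n → P (single w 1) := by
      intro m
      induction m using Nat.strong_induction_on with
      | _ m ih =>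
        intro w hm hn
        obtain ⟨⟨l, x, r⟩, rfl⟩ := e.surjective w
        have h1 : single (e (l, x, r)) 1 =
            tripleProd p s l x r + (-1 : K) • E (e (l, x, r)) := by
          rw [hEe l x r]; simp
        have h0 : P 0 := by simpa using hsmul 0 _ (hT l x r hn)
        have h2 : P (E (e (l, x, r))) := by
          rw [← Finsupp.sum_single (E (e (l, x, r))), Finsupp.sum]
          refine Finset.sum_induction _ P hadd h0 fun w' hw' => ?_
          have h3 := hE _ w' hw'
          have := hsmul (E (e (l, x, r)) w') _ (ih _ (hm ▸ h3.2) w' rfl (h3.1.trans hn))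
          simpa using this
        rw [h1]
        exact hadd _ _ (hT l x r hn) (hsmul _ _ h2)
    exact fun w => key _ w rfl
  obtain ⟨g, hg⟩ := exists_triangular_recursion deg c e hl hr E hE p' s' f
  let φ : (W →₀ K) →ₗ[K] B := linearCombination K g
  have φs : ∀ w, φ (single w 1) = g w := fun w => by simp [φ]
  have φT : ∀ l (x : X) r, φ (tripleProd p s l x r) =
      succOpt s' (l.map g) (precOpt p' (f x) (r.map g)) := by
    intro l x r
    rw [hEe, map_add, φs, hg, sub_add_cancel]
  -- The compatibility `φT` is needed with an arbitrary vector on the right, since the axioms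
  -- produce `r ≺ v + r ≻ v`, which is not a basis element. `φl` is the mirror statement.
  have φr : ∀ (l : Option W) (x : X) (b : W →₀ K),
      φ (succOpt s (l.map fun a => single a 1) (p (single x.1 1) b)) =
        succOpt s' (l.map g) (p' (f x) (φ b)) := by
    intro l x b
    induction b using Finsupp.induction_linear with
    | zero => cases l <;> simp [succOpt]
    | add b c hb hc =>
      cases l with
      | none =>
        simp only [succOpt, Option.map_none, Option.elim_none, map_add] at hb hc ⊢
        rw [hb, hc]
      | some l =>
        simp only [succOpt, Option.map_some, Option.elim_some, map_add] at hb hc ⊢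
        rw [hb, hc]
    | single w k =>
      have := φT l x (some w)
      rw [single_eq_smul_single w k]
      cases l with
      | none =>
        simp only [succOpt, precOpt, tripleProd, Option.map_none, Option.map_some,
          Option.elim_none, Option.elim_some] at this ⊢
        simp only [map_smul, this, φs]
      | some l =>
        simp only [succOpt, precOpt, tripleProd, Option.map_some, Option.elim_some] at this ⊢
        simp only [map_smul, this, φs]
  have φl : ∀ (a : W →₀ K) (x : X) (r : Option W),
      φ (s a (precOpt p (single x.1 1) (r.map fun a => single a 1))) =
        s' (φ a) (precOpt p' (f x) (r.map g)) := by
    intro a x r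
    induction a using Finsupp.induction_linear with
    | zero => simp
    | add b c hb hc => simp only [map_add, LinearMap.add_apply, hb, hc]
    | single w k =>
      have := φT (some w) x r
      rw [single_eq_smul_single w k]
      simp only [succOpt, tripleProd, Option.map_some, Option.elim_some] at this
      simp only [map_smul, LinearMap.smul_apply, this, φs]
  -- By `ind`, one operand may be taken of the form `l ≻ x ≺ r` without changing its degree. The
  -- axioms give `(l ≻ x ≺ r) ≺ v = l ≻ (x ≺ (r ≺ v + r ≻ v))`, and `r` has smaller degree than the
  -- operand; symmetrically for `≻` on the other side.
  have mul : ∀ n u v, deg u + deg v = n →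
      φ (p (single u 1) (single v 1)) = p' (g u) (g v) ∧
      φ (s (single u 1) (single v 1)) = s' (g u) (g v) := by
    intro n
    induction n using Nat.strong_induction_on with
    | _ n ih =>
      intro u v huv
      constructor
      · rw [← φs u]
        refine ind (deg u) (fun a => φ (p a (single v 1)) = p' (φ a) (g v)) ?_ ?_ ?_ u rfl
        · intro a b ha hb; simp [ha, hb]
        · intro k a ha; simp [ha]
        · intro l x r hlr
          rw [φT, h'.prec_succOpt, tripleProd, h.prec_succOpt]
          cases r with
          | none => simpa [precOpt, φs] using φr l x (single v 1)
          | some r =>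
            have hlt := hr l x r
            obtain ⟨i1, i2⟩ := ih (deg r + deg v) (by omega) r v rfl
            simp only [precOpt, Option.map_some, Option.elim_some, h.prec_prec, h'.prec_prec]
            rw [φr, map_add, i1, i2]
      · rw [← φs v]
        refine ind (deg v) (fun b => φ (s (single u 1) b) = s' (g u) (φ b)) ?_ ?_ ?_ v rfl
        · intro a b ha hb; simp [ha, hb]
        · intro k a ha; simp [ha]
        · intro l x r hlr
          rw [φT, tripleProd]
          cases l with
          | none => simpa [succOpt, φs] using φl (single u 1) x r
          | some l =>
            have hlt := hl l x r
            obtain ⟨i1, i2⟩ := ih (deg u + deg l) (by omega) u l rfl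
            simp only [succOpt, Option.map_some, Option.elim_some, ← h.succ_succ, ← h'.succ_succ]
            rw [φl, map_add, i1, i2]
  have ext2 : ∀ (q : (W →₀ K) →ₗ[K] (W →₀ K) →ₗ[K] (W →₀ K)) (q' : B →ₗ[K] B →ₗ[K] B),
      (∀ u v, φ (q (single u 1) (single v 1)) = q' (g u) (g v)) →
      ∀ x y, φ (q x y) = q' (φ x) (φ y) := by
    intro q q' hq x y
    induction x using Finsupp.induction_linear with
    | zero => simp
    | add b c hb hc => simp only [map_add, LinearMap.add_apply, hb, hc]
    | single w k =>
      rw [single_eq_smul_single w k]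
      simp only [map_smul, LinearMap.smul_apply, φs]
      congr 1
      induction y using Finsupp.induction_linear with
      | zero => simp
      | add b c hb hc => simp only [map_add, hb, hc]
      | single w' k' =>
        rw [single_eq_smul_single w' k']
        simp only [map_smul, φs, hq]
  refine ⟨φ, ⟨ext2 p p' fun u v => (mul _ u v rfl).1, ext2 s s' fun u v => (mul _ u v rfl).2, ?_⟩,
    ?_⟩
  · rintro ⟨_, x, hx, rfl⟩
    simpa [tripleProd, succOpt, precOpt] using φT none ⟨x, hx⟩ none
  · rintro ψ ⟨ψp, ψs, ψf⟩
    -- On `l ≻ x ≺ r` a morphism is determined by its values at `x`, `l` and `r`, the last two being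
    -- of smaller degree.
    have key : ∀ n w, deg w = n → ψ (single w 1) = φ (single w 1) := by
      intro n
      induction n using Nat.strong_induction_on with
      | _ n ih =>
        refine ind n (fun a => ψ a = φ a) ?_ ?_ ?_
        · intro a b ha hb; simp [ha, hb]
        · intro k a ha; simp [ha]
        · intro l x r hlr
          rw [φT]
          have hx : ψ (single x.1 1) = f x := ψf ⟨single x.1 1, x.1, x.2, rfl⟩
          have h1 : ∀ l' ∈ l, ψ (single l' 1) = g l' := by
            rintro l' ⟨⟩
            rw [ih _ (hlr ▸ hl l' x r) l' rfl, φs]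
          have h2 : ∀ r' ∈ r, ψ (single r' 1) = g r' := by
            rintro r' ⟨⟩
            rw [ih _ (hlr ▸ hr l x r') r' rfl, φs]
          cases l <;> cases r <;>
            simp_all only [tripleProd, succOpt, precOpt, Option.map_none, Option.map_some,
              Option.elim_none, Option.elim_some, Option.mem_def, Option.some.injEq,
              forall_eq']
    refine Finsupp.lhom_ext' fun w => LinearMap.ext_ring ?_
    simpa using key _ w rfl

/-- Freeness is transported along linear isomorphisms. -/
theorem IsFreeDendriform.of_equiv {A : Type v} [AddCommGroup A] [Module K A]
    {p s q t : A →ₗ[K] A →ₗ[K] A} (e : A ≃ₗ[K] A)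
    (hp : ∀ x y, q (e x) (e y) = e (p x y)) (hs : ∀ x y, t (e x) (e y) = e (s x y))
    (h : IsFreeDendriform.{u, v, w} p s) : IsFreeDendriform.{u, v, w} q t := by
  obtain ⟨hd, X, hX⟩ := h
  refine ⟨⟨?_, ?_, ?_⟩, e '' X, ?_⟩
  · intro x y z
    obtain ⟨x, rfl⟩ := e.surjective x
    obtain ⟨y, rfl⟩ := e.surjective y
    obtain ⟨z, rfl⟩ := e.surjective z
    rw [hp, hp, hp, hs, ← map_add, hp, hd.prec_prec]
  · intro x y z
    obtain ⟨x, rfl⟩ := e.surjective x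
    obtain ⟨y, rfl⟩ := e.surjective y
    obtain ⟨z, rfl⟩ := e.surjective z
    rw [hs, hp, hp, hs, hd.succ_prec]
  · intro x y z
    obtain ⟨x, rfl⟩ := e.surjective x
    obtain ⟨y, rfl⟩ := e.surjective y
    obtain ⟨z, rfl⟩ := e.surjective z
    rw [hp, hs, hs, ← map_add, hs, hs, hd.succ_succ]
  · intro B _ _ p' s' hB f
    obtain ⟨φ, ⟨h1, h2, h3⟩, hu⟩ := hX B p' s' hB fun x => f ⟨e x, x, x.2, rfl⟩
    refine ⟨φ ∘ₗ e.symm.toLinearMap, ⟨?_, ?_, ?_⟩, ?_⟩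
    · intro x y
      obtain ⟨x, rfl⟩ := e.surjective x
      obtain ⟨y, rfl⟩ := e.surjective y
      simp [hp, h1]
    · intro x y
      obtain ⟨x, rfl⟩ := e.surjective x
      obtain ⟨y, rfl⟩ := e.surjective y
      simp [hs, h2]
    · rintro ⟨_, x, hx, rfl⟩
      simpa using h3 ⟨x, hx⟩
    · rintro ψ ⟨k1, k2, k3⟩
      have := hu (ψ ∘ₗ e.toLinearMap) ⟨fun x y => by simp [← hp, k1],
        fun x y => by simp [← hs, k2], fun x => by simpa using k3 ⟨e x, x, x.2, rfl⟩⟩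
      rw [← this]
      ext x
      simp

end Free

/-! ### Packing and relative order of letters -/

section Packing

theorem le_maxLetter {x : List ℕ} {c : ℕ} (hc : c ∈ x) : c ≤ maxLetter x :=
  Finset.le_sup (f := id) (List.mem_toFinset.2 hc)

theorem maxLetter_mem {x : List ℕ} (hx : x ≠ []) : maxLetter x ∈ x := by
  obtain ⟨a, ha, h⟩ := Finset.exists_mem_eq_sup x.toFinset (by simpa using hx) id
  rw [maxLetter, h]
  exact List.mem_toFinset.1 ha

theorem maxLetter_append (x y : List ℕ) :
    maxLetter (x ++ y) = max (maxLetter x) (maxLetter y) := by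
  simp [maxLetter, Finset.sup_union]

theorem maxLetter_lt_iff {x y : List ℕ} (hx : x ≠ []) (hy : y ≠ []) :
    maxLetter y < maxLetter x ↔ ∀ b ∈ y, ∃ a ∈ x, b < a := by
  constructor
  · intro h b hb
    exact ⟨_, maxLetter_mem hx, (le_maxLetter hb).trans_lt h⟩
  · intro h
    obtain ⟨a, ha, hab⟩ := h _ (maxLetter_mem hy)
    exact hab.trans_le (le_maxLetter ha)

/-- The rank of a letter in the set of letters of a word. -/
def letterRank (x : List ℕ) (a : ℕ) : ℕ := (x.toFinset.filter (· ≤ a)).card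

theorem pack_eq_map (x : List ℕ) : pack x = x.map (letterRank x) := rfl

theorem letterRank_lt_iff {x : List ℕ} {a b : ℕ} (hb : b ∈ x) :
    letterRank x a < letterRank x b ↔ a < b := by
  constructor
  · intro h
    by_contra! hab
    refine absurd h (not_lt.2 (Finset.card_le_card fun c hc => ?_))
    simp only [Finset.mem_filter] at hc ⊢
    exact ⟨hc.1, hc.2.trans hab⟩
  · intro hab
    refine Finset.card_lt_card ((Finset.ssubset_iff_of_subset fun c hc => ?_).2 ⟨b, ?_, ?_⟩)
    · simp only [Finset.mem_filter] at hc ⊢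
      exact ⟨hc.1, hc.2.trans hab.le⟩
    · simpa using hb
    · simp [hab]

theorem length_pack (x : List ℕ) : (pack x).length = x.length := by simp [pack]

theorem pack_ne_nil {x : List ℕ} : pack x ≠ [] ↔ x ≠ [] := by simp [pack]

/-- Ranks are injective on letters and lie between 1 and the number of distinct letters, so by
counting they fill that interval. -/
theorem isPacked_pack (x : List ℕ) : IsPacked (pack x) := by
  have h1 : (pack x).toFinset = x.toFinset.image (letterRank x) := by
    ext a; simp [pack_eq_map]
  have h2 : (pack x).toFinset = Finset.Icc 1 x.toFinset.card := by
    rw [h1]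
    refine Finset.eq_of_subset_of_card_le (fun c hc => ?_) ?_
    · obtain ⟨a, ha, rfl⟩ := Finset.mem_image.1 hc
      rw [Finset.mem_Icc]
      exact ⟨Finset.card_pos.2 ⟨a, by simpa using ha⟩,
        Finset.card_le_card (Finset.filter_subset _ _)⟩
    · rw [Finset.card_image_of_injOn, Nat.card_Icc, Nat.add_sub_cancel]
      intro a ha b hb hab
      simp only [Finset.mem_coe, List.mem_toFinset] at ha hb
      rcases lt_trichotomy a b with h | h | h
      · exact absurd hab ((letterRank_lt_iff hb).2 h).ne
      · exact h
      · exact absurd hab ((letterRank_lt_iff ha).2 h).ne'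
  have h3 : maxLetter (pack x) = x.toFinset.card := by
    rw [maxLetter, h2]
    rcases Nat.eq_zero_or_pos x.toFinset.card with h | h
    · rw [h]; rfl
    · exact le_antisymm (Finset.sup_le fun c hc => (Finset.mem_Icc.1 hc).2)
        (Finset.le_sup (f := id) (Finset.mem_Icc.2 ⟨h, le_rfl⟩))
  rw [IsPacked, h2, h3]

theorem IsPacked.pack_eq {x : List ℕ} (hx : IsPacked x) : pack x = x := by
  rw [pack_eq_map]
  conv_rhs => rw [← List.map_id x]
  refine List.map_congr_left fun a ha => ?_
  have ha' : a ∈ Finset.Icc 1 (maxLetter x) := by rw [← hx]; simpa using ha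
  rw [letterRank, hx]
  have : (Finset.Icc 1 (maxLetter x)).filter (· ≤ a) = Finset.Icc 1 a := by
    ext c
    simp only [Finset.mem_filter, Finset.mem_Icc] at ha' ⊢
    omega
  rw [this]
  simp

theorem IsPacked.pos {x : List ℕ} (hx : IsPacked x) {a : ℕ} (ha : a ∈ x) : 1 ≤ a := by
  have : a ∈ Finset.Icc 1 (maxLetter x) := by rw [← hx]; simpa using ha
  exact (Finset.mem_Icc.1 this).1

/-- The two words read off a word of pairs have their letters in the same relative order. -/
def OrderEquivalent (z : List (ℕ × ℕ)) : Prop := ∀ p ∈ z, ∀ q ∈ z, p.1 < q.1 ↔ p.2 < q.2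

/-- The letters counted by corresponding ranks are the two projections of one set of pairs, and both
projections are injective on it. -/
theorem OrderEquivalent.pack_eq {z : List (ℕ × ℕ)} (hz : OrderEquivalent z) :
    pack (z.map Prod.fst) = pack (z.map Prod.snd) := by
  rw [pack_eq_map, pack_eq_map, List.map_map, List.map_map]
  refine List.map_congr_left fun p hp => ?_
  have h1 : ((z.map Prod.fst).toFinset.filter (· ≤ p.1)) =
      (z.toFinset.filter fun q => q.1 ≤ p.1).image Prod.fst := by
    ext c; simp
  have h2 : ((z.map Prod.snd).toFinset.filter (· ≤ p.2)) =
      (z.toFinset.filter fun q => q.1 ≤ p.1).image Prod.snd := by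
    ext c
    simp only [Finset.mem_filter, Finset.mem_image, List.mem_toFinset, List.mem_map]
    constructor
    · rintro ⟨⟨q, hq, rfl⟩, h⟩
      exact ⟨q, ⟨hq, not_lt.1 fun h' => not_lt.2 h ((hz p hp q hq).1 h')⟩, rfl⟩
    · rintro ⟨q, ⟨hq, h⟩, rfl⟩
      exact ⟨⟨q, hq, rfl⟩, not_lt.1 fun h' => not_lt.2 h ((hz p hp q hq).2 h')⟩
  have inj : ∀ p ∈ z, ∀ q ∈ z, p.1 = q.1 ↔ p.2 = q.2 := by
    intro p hp q hq
    have h1 := hz p hp q hq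
    have h2 := hz q hq p hp
    omega
  simp only [Function.comp, letterRank]
  rw [h1, h2, Finset.card_image_of_injOn, Finset.card_image_of_injOn]
  all_goals
    intro q hq q' hq' h
    simp only [Finset.coe_filter, List.mem_toFinset, Set.mem_ofPred_eq] at hq hq'
    have := inj q hq.1 q' hq'.1
    exact Prod.ext (by tauto) (by tauto)

/-- Equal packings mean equal ranks position by position, so zipping works. Two words with the same
packing can thus be handled as one word of pairs. -/
theorem exists_orderEquivalent {x y : List ℕ} (h : pack x = pack y) :
    ∃ z : List (ℕ × ℕ), z.map Prod.fst = x ∧ z.map Prod.snd = y ∧ OrderEquivalent z := by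
  have hl : x.length = y.length := by rw [← length_pack x, h, length_pack]
  have key : ∀ p ∈ x.zip y, letterRank x p.1 = letterRank y p.2 := by
    intro p hp
    obtain ⟨i, hi, rfl⟩ := List.mem_iff_getElem.1 hp
    have hi' : i < x.length := by simp at hi; omega
    have := congrArg (fun l => l[i]?) h
    simpa [pack_eq_map, hi', hl ▸ hi'] using this
  refine ⟨x.zip y, List.map_fst_zip hl.le, List.map_snd_zip hl.ge, fun p hp q hq => ?_⟩
  rw [← letterRank_lt_iff (List.of_mem_zip hq).1, key p hp, key q hq,
    letterRank_lt_iff (List.of_mem_zip hq).2]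

theorem pack_map {x : List ℕ} {f : ℕ → ℕ} (hf : ∀ a ∈ x, ∀ b ∈ x, f a < f b ↔ a < b) :
    pack (x.map f) = pack x := by
  have : OrderEquivalent (x.map fun a => (f a, a)) := by
    intro p hp q hq
    obtain ⟨a, ha, rfl⟩ := List.mem_map.1 hp
    obtain ⟨b, hb, rfl⟩ := List.mem_map.1 hq
    exact hf a ha b hb
  simpa [Function.comp_def] using this.pack_eq

theorem pack_map_letterRank {x y : List ℕ} (h : ∀ a ∈ x, a ∈ y) :
    pack (x.map (letterRank y)) = pack x :=
  pack_map fun _ _ _ hb => letterRank_lt_iff (h _ hb)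

end Packing

/-! ### Ascents and the equality case of their monotonicity -/

section Ascents

/-- The number of pairs of positions `i < j` with `x(i) < x(j)`. -/
def ascents : List ℕ → ℕ
  | [] => 0
  | a :: x => x.countP (a < ·) + ascents x

theorem ascents_le_of_pairwise {z : List (ℕ × ℕ)}
    (h : z.Pairwise fun p q => p.1 < q.1 → p.2 < q.2) :
    ascents (z.map Prod.fst) ≤ ascents (z.map Prod.snd) := by
  induction z with
  | nil => exact le_rfl
  | cons p z ih =>
    rw [List.pairwise_cons] at h
    simp only [List.map_cons, ascents, List.countP_map]
    exact add_le_add (List.countP_mono_left fun q hq => by simpa using h.1 q hq) (ih h.2)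

theorem countP_eq_imp {α : Type*} {P Q : α → Bool} {l : List α} (h : ∀ a ∈ l, P a → Q a)
    (he : l.countP Q ≤ l.countP P) : ∀ a ∈ l, Q a → P a := by
  induction l with
  | nil => simp
  | cons a l ih =>
    have h1 : l.countP P ≤ l.countP Q :=
      List.countP_mono_left fun b hb => h b (List.mem_cons_of_mem _ hb)
    have h2 := h a List.mem_cons_self
    have h3 := ih (fun b hb => h b (List.mem_cons_of_mem _ hb))
    simp only [List.countP_cons] at he
    intro b hb hQ
    rcases List.mem_cons.1 hb with rfl | hb
    · by_contra hP
      simp [hP, hQ] at he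
      omega
    · refine h3 ?_ b hb hQ
      by_cases hPa : P a
      · simp [hPa, h2 hPa] at he; exact he
      · simp [hPa] at he; omega

/-- No ascent is lost in passing from the first word to the second; if the total does not grow, none
is gained either. -/
theorem pairwise_of_ascents_le {z : List (ℕ × ℕ)}
    (h : z.Pairwise fun p q => p.1 < q.1 → p.2 < q.2)
    (he : ascents (z.map Prod.snd) ≤ ascents (z.map Prod.fst)) :
    z.Pairwise fun p q => p.2 < q.2 → p.1 < q.1 := by
  induction z with
  | nil => exact List.Pairwise.nil
  | cons p z ih =>
    rw [List.pairwise_cons] at h ⊢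
    have h1 := ascents_le_of_pairwise h.2
    have h2 : (z.countP fun q => p.1 < q.1) ≤ (z.countP fun q => p.2 < q.2) :=
      List.countP_mono_left fun q hq => by simpa using h.1 q hq
    simp only [List.map_cons, ascents, List.countP_map, Function.comp_def] at he
    refine ⟨fun q hq => ?_, ih h.2 (by omega)⟩
    have := countP_eq_imp (P := fun q : ℕ × ℕ => decide (p.1 < q.1))
      (Q := fun q : ℕ × ℕ => decide (p.2 < q.2)) (l := z)
      (fun q hq => by simpa using h.1 q hq) (by omega) q hq
    simpa using this

end Ascents

/-! ### Layered words and their unique factorization -/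

section Layered

/-- The word `L M R` is layered: the letters of `L` come first, followed by the letters of `M`
different from its maximum, then by the letters of `R`, and finally by the maximum of `M`. -/
structure Layered (L M R : List ℕ) : Prop where
  left_lt_mid : ∀ a ∈ L, ∀ b ∈ M, a < b
  left_lt_right : ∀ a ∈ L, ∀ c ∈ R, a < c
  mid_lt_right : ∀ b ∈ M, (∃ b' ∈ M, b < b') → ∀ c ∈ R, b < c
  right_lt_max : ∀ c ∈ R, ∃ b ∈ M, c < b

theorem layered_nil (M : List ℕ) : Layered [] M [] := by
  constructor <;> simp

theorem layered_map_iff {L M R : List ℕ} {f : ℕ → ℕ}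
    (hf : ∀ a ∈ L ++ M ++ R, ∀ b ∈ L ++ M ++ R, f a < f b ↔ a < b) :
    Layered (L.map f) (M.map f) (R.map f) ↔ Layered L M R := by
  simp only [List.mem_append] at hf
  constructor
  · rintro ⟨h1, h2, h3, h4⟩
    simp only [List.mem_map, forall_exists_index, and_imp, forall_apply_eq_imp_iff₂,
      exists_exists_and_eq_and] at h1 h2 h3 h4
    constructor <;> grind
  · rintro ⟨h1, h2, h3, h4⟩
    constructor <;> simp only [List.mem_map, forall_exists_index, and_imp,
      forall_apply_eq_imp_iff₂, exists_exists_and_eq_and] <;> grind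

/-- Layering fixes every comparison between letters of different blocks. Between `M` and `R` it
depends only on whether the letter of `M` is its maximum, and this is visible in the packing of `M`.
-/
theorem Layered.pack_eq {L M R L' M' R' : List ℕ} (h : Layered L M R) (h' : Layered L' M' R')
    (hL : pack L = pack L') (hM : pack M = pack M') (hR : pack R = pack R') :
    pack (L ++ M ++ R) = pack (L' ++ M' ++ R') := by
  obtain ⟨x, rfl, rfl, hx⟩ := exists_orderEquivalent hL
  obtain ⟨y, rfl, rfl, hy⟩ := exists_orderEquivalent hM
  obtain ⟨z, rfl, rfl, hz⟩ := exists_orderEquivalent hR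
  obtain ⟨h1, h2, h3, h4⟩ := h
  obtain ⟨k1, k2, k3, k4⟩ := h'
  simp only [List.mem_map, forall_exists_index, and_imp, forall_apply_eq_imp_iff₂,
      exists_exists_and_eq_and] at h1 h2 h3 h4 k1 k2 k3 k4
  have hyz : ∀ p ∈ y, ∀ q ∈ z, (p.1 < q.1 ↔ p.2 < q.2) ∧ (q.1 < p.1 ↔ q.2 < p.2) := by
    intro p hp q hq
    by_cases hmax : ∃ p' ∈ y, p.1 < p'.1
    · obtain ⟨p', hp', hlt⟩ := hmax
      have a1 := h3 p hp p' hp' hlt q hq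
      have a2 := k3 p hp p' hp' ((hy p hp p' hp').1 hlt) q hq
      omega
    · push Not at hmax
      obtain ⟨b, hb, hqb⟩ := h4 q hq
      obtain ⟨b', hb', hqb'⟩ := k4 q hq
      have a1 := hmax b hb
      have a2 := hmax b' hb'
      have a3 := hy p hp b' hb'
      omega
  have : OrderEquivalent (x ++ y ++ z) := by
    intro p hp q hq
    simp only [List.mem_append] at hp hq
    rcases hp with (hp | hp) | hp <;> rcases hq with (hq | hq) | hq
    · exact hx p hp q hq
    · exact iff_of_true (h1 p hp q hq) (k1 p hp q hq)
    · exact iff_of_true (h2 p hp q hq) (k2 p hp q hq)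
    · exact iff_of_false (h1 q hq p hp).not_gt (k1 q hq p hp).not_gt
    · exact hy p hp q hq
    · exact (hyz p hp q hq).1
    · exact iff_of_false (h2 q hq p hp).not_gt (k2 q hq p hp).not_gt
    · exact (hyz q hq p hp).2
    · exact hz p hp q hq
  simpa using this.pack_eq

/-- Among the words with given packed blocks, such that the maximum of the middle block is larger
than the letters of the right block, the layered ones have the most ascents. -/
theorem Layered.ascents_lt_or {L M R L' M' R' : List ℕ} (h' : Layered L' M' R')
    (hL : pack L = pack L') (hM : pack M = pack M') (hR : pack R = pack R')
    (hmax : ∀ c ∈ R, ∃ b ∈ M, c < b) :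
    ascents (L ++ M ++ R) < ascents (L' ++ M' ++ R') ∨ Layered L M R := by
  obtain ⟨x, rfl, rfl, hx⟩ := exists_orderEquivalent hL
  obtain ⟨y, rfl, rfl, hy⟩ := exists_orderEquivalent hM
  obtain ⟨z, rfl, rfl, hz⟩ := exists_orderEquivalent hR
  obtain ⟨k1, k2, k3, k4⟩ := h'
  simp only [List.mem_map, forall_exists_index, and_imp, forall_apply_eq_imp_iff₂,
      exists_exists_and_eq_and] at k1 k2 k3 k4 hmax
  have hP : (x ++ y ++ z).Pairwise fun p q => p.1 < q.1 → p.2 < q.2 := by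
    simp only [List.pairwise_append, List.mem_append]
    refine ⟨⟨?_, ?_, fun p hp q hq _ => k1 p hp q hq⟩, ?_, ?_⟩
    · exact List.pairwise_of_forall_mem_list fun p hp q hq => (hx p hp q hq).1
    · exact List.pairwise_of_forall_mem_list fun p hp q hq => (hy p hp q hq).1
    · exact List.pairwise_of_forall_mem_list fun p hp q hq => (hz p hp q hq).1
    · rintro p (hp | hp) q hq hlt
      · exact k2 p hp q hq
      -- An ascent from `M` to `R` starts below the maximum of `M`, because that maximum exceeds all
      -- of `R`; the layered word therefore has it too.
      · obtain ⟨b, hb, hqb⟩ := hmax q hq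
        exact k3 p hp b hb ((hy p hp b hb).1 (hlt.trans hqb)) q hq
  by_cases he : ascents (x.map Prod.snd ++ y.map Prod.snd ++ z.map Prod.snd) ≤
      ascents (x.map Prod.fst ++ y.map Prod.fst ++ z.map Prod.fst)
  · right
    -- In the equality case every ascent of the layered word between two blocks is already present,
    -- and these ascents are the layering conditions.
    have hP' := pairwise_of_ascents_le hP (by simpa using he)
    simp only [List.pairwise_append, List.mem_append] at hP'
    obtain ⟨⟨-, -, j1⟩, -, j2⟩ := hP'
    constructor <;> simp only [List.mem_map, forall_exists_index, and_imp,
      forall_apply_eq_imp_iff₂, exists_exists_and_eq_and]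
    · exact fun p hp q hq => j1 p hp q hq (k1 p hp q hq)
    · exact fun p hp q hq => j2 p (Or.inl hp) q hq (k2 p hp q hq)
    · exact fun p hp p' hp' hlt q hq =>
        j2 p (Or.inr hp) q hq (k3 p hp p' hp' ((hy p hp p' hp').1 hlt) q hq)
    · exact hmax
  · exact Or.inl (not_le.1 he)

theorem exists_layered (l m r : List ℕ) (hm0 : m ≠ []) (hm : ∀ a ∈ m, 1 ≤ a)
    (hr : ∀ a ∈ r, 1 ≤ a) :
    ∃ L M R, Layered L M R ∧ pack L = pack l ∧ pack M = pack m ∧ pack R = pack r := by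
  have hl' : ∀ a ∈ l, a ≤ maxLetter l := fun a => le_maxLetter
  have hm' : ∀ a ∈ m, a ≤ maxLetter m := fun a => le_maxLetter
  have hr' : ∀ a ∈ r, a ≤ maxLetter r := fun a => le_maxLetter
  have hmm := maxLetter_mem hm0
  -- The shifts place `l` lowest, the nonmaximal letters of `m` strictly below `maxLetter l +
  -- maxLetter m`, the letters of `r` just above that value, and the maximum of `m` above
  -- everything.
  refine ⟨l, m.map fun a => if a < maxLetter m then maxLetter l + a else
    maxLetter l + maxLetter m + maxLetter r + 1, r.map (maxLetter l + maxLetter m + ·), ?_, rfl,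
    pack_map ?_, pack_map ?_⟩
  · constructor <;> simp only [List.mem_map, forall_exists_index, and_imp,
      forall_apply_eq_imp_iff₂, exists_exists_and_eq_and]
    · intro a ha b hb
      have := hl' a ha
      have := hm b hb
      split_ifs <;> omega
    · intro a ha c hc
      have := hl' a ha
      have := hr c hc
      omega
    · intro b hb b' hb' hlt c hc
      have := hr c hc
      split_ifs at hlt ⊢ <;> omega
    · intro c hc
      refine ⟨_, hmm, ?_⟩
      have := hr' c hc
      rw [if_neg (lt_irrefl _)]
      omega
  · intro a ha b hb
    have := hm' a ha
    have := hm' b hb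
    split_ifs <;> omega
  · intro a _ b _
    omega

/-- A word is irreducible if it has no nontrivial layered factorization. -/
def LayerIrreducible (x : List ℕ) : Prop :=
  ∀ L M R, x = L ++ M ++ R → M ≠ [] → Layered L M R → L = [] ∧ R = []

theorem layerIrreducible_pack {x : List ℕ} : LayerIrreducible (pack x) ↔ LayerIrreducible x := by
  constructor
  · rintro h L M R rfl hM hl
    have := h (L.map (letterRank (L ++ M ++ R))) (M.map (letterRank (L ++ M ++ R)))
      (R.map (letterRank (L ++ M ++ R))) (by simp [pack_eq_map]) (by simpa using hM)
      ((layered_map_iff fun a _ b hb => letterRank_lt_iff hb).2 hl)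
    simpa using this
  · intro h L' M' R' he hM hl
    rw [pack_eq_map, List.map_eq_append_iff] at he
    obtain ⟨y, R, hx, he, rfl⟩ := he
    rw [List.map_eq_append_iff] at he
    obtain ⟨L, M, rfl, rfl, rfl⟩ := he
    have := h L M R hx (by simpa using hM)
      ((layered_map_iff fun a _ b hb => letterRank_lt_iff (hx ▸ hb)).1 hl)
    simpa using this

/-- A nontrivial factorization has a shorter middle block. Factoring that block again and merging
the outer blocks keeps the word layered. -/
theorem exists_layerIrreducible (x : List ℕ) (hx : x ≠ []) :
    ∃ L M R, x = L ++ M ++ R ∧ M ≠ [] ∧ Layered L M R ∧ LayerIrreducible M := by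
  induction hn : x.length using Nat.strong_induction_on generalizing x with
  | _ n ih =>
    by_cases hirr : LayerIrreducible x
    · exact ⟨[], x, [], by simp, hx, layered_nil x, hirr⟩
    · simp only [LayerIrreducible, not_forall] at hirr
      obtain ⟨L, M, R, rfl, hM, hl, hne⟩ := hirr
      have hlen : M.length < n := by
        simp only [← List.length_eq_zero_iff, List.length_append] at hne hn
        omega
      obtain ⟨L', M', R', rfl, hM', hl', hirr'⟩ := ih _ hlen M hM rfl
      refine ⟨L ++ L', M', R' ++ R, by simp, hM', ?_, hirr'⟩
      obtain ⟨h1, h2, h3, h4⟩ := hl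
      obtain ⟨k1, k2, k3, k4⟩ := hl'
      simp only [List.mem_append] at h1 h2 h3 h4
      obtain ⟨b₀, hb₀⟩ := List.exists_mem_of_ne_nil _ hM'
      constructor <;> simp only [List.mem_append]
      · rintro a (ha | ha) b hb
        · exact h1 a ha b (by tauto)
        · exact k1 a ha b hb
      · rintro a (ha | ha) c (hc | hc)
        · exact h1 a ha c (by tauto)
        · exact h2 a ha c hc
        · exact k2 a ha c hc
        · exact h3 a (by tauto) ⟨b₀, by tauto, k1 a ha b₀ hb₀⟩ c hc
      · rintro b hb ⟨b', hb', hlt⟩ c (hc | hc)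
        · exact k3 b hb ⟨b', hb', hlt⟩ c hc
        · exact h3 b (by tauto) ⟨b', by tauto, hlt⟩ c hc
      · rintro c (hc | hc)
        · exact k4 c hc
        -- A letter of the old middle block above `c` may lie in `L'` or `R'`, but some letter of
        -- `M'` is larger still.
        · obtain ⟨b, hb, hcb⟩ := h4 c hc
          rcases hb with (hb | hb) | hb
          · exact ⟨b₀, hb₀, hcb.trans (k1 b hb b₀ hb₀)⟩
          · exact ⟨b, hb, hcb⟩
          · obtain ⟨b', hb', hlt⟩ := k4 b hb
            exact ⟨b', hb', hcb.trans hlt⟩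

/-- If `t` covers `M`, then `M'` lies inside `R`, hence below the maximum of `M`, whereas `t` must
lie below `M'`. Otherwise `t` is a proper prefix of `M` lying below the rest of `M`, and
irreducibility makes it empty. -/
theorem left_eq_of_layered {M R M' R' L t : List ℕ} (he : M ++ R = t ++ (M' ++ R'))
    (hM' : M' ≠ []) (hl : Layered L M R) (hl' : Layered (L ++ t) M' R')
    (hirr : LayerIrreducible M) : t = [] := by
  have hMR : ∀ a, a ∈ M ∨ a ∈ R ↔ a ∈ t ∨ a ∈ M' ∨ a ∈ R' := by
    intro a
    simpa using congrArg (a ∈ ·) he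
  rcases List.append_eq_append_iff.1 he with ⟨t', rfl, rfl⟩ | ⟨s, rfl, hs⟩
  · obtain ⟨b', hb'⟩ := List.exists_mem_of_ne_nil _ hM'
    obtain ⟨b, hb, hlt⟩ := hl.right_lt_max b' (by simp [hb'])
    exact absurd hlt (hl'.left_lt_mid b (by simp [hb]) b' hb').not_gt
  · by_cases hs0 : s = []
    · subst hs0
      obtain ⟨b', hb'⟩ := List.exists_mem_of_ne_nil _ hM'
      have hb'' : b' ∈ R := by
        have : b' ∈ M' ++ R' := by simp [hb']
        rw [hs] at this
        simpa using this
      obtain ⟨b, hb, hlt⟩ := hl.right_lt_max b' hb''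
      exact absurd hlt (hl'.left_lt_mid b (by simp at hb; simp [hb]) b' hb').not_gt
    · refine (hirr t s [] (by simp) hs0 ⟨fun a ha b hb => ?_, by simp, by simp, by simp⟩).1
      have : b ∈ M' ++ R' := by rw [hs]; simp [hb]
      rcases List.mem_append.1 this with hb' | hb'
      · exact hl'.left_lt_mid a (by simp [ha]) b hb'
      · exact hl'.left_lt_right a (by simp [ha]) b hb'

/-- The layering of `M` with `t ++ R` restricts to `M` with `t`, so a nonempty `t` would factor `M
++ t` nontrivially. -/
theorem right_eq_of_layered {M R t : List ℕ} {L : List ℕ} (hM : M ≠ [])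
    (hl : Layered L M (t ++ R)) (hirr : LayerIrreducible (M ++ t)) : t = [] := by
  refine (hirr [] M t (by simp) hM ⟨by simp, by simp, fun b hb hb' c hc => ?_, fun c hc => ?_⟩).2
  · exact hl.mid_lt_right b hb hb' c (by simp [hc])
  · exact hl.right_lt_max c (by simp [hc])

theorem layered_unique {L M R L' M' R' : List ℕ} (he : L ++ M ++ R = L' ++ M' ++ R')
    (hM : M ≠ []) (hM' : M' ≠ []) (hl : Layered L M R) (hl' : Layered L' M' R')
    (hirr : LayerIrreducible M) (hirr' : LayerIrreducible M') :
    L = L' ∧ M = M' ∧ R = R' := by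
  have hL : L = L' := by
    rw [List.append_assoc, List.append_assoc] at he
    rcases List.append_eq_append_iff.1 he with ⟨t, rfl, h⟩ | ⟨t, rfl, h⟩
    · simp [left_eq_of_layered h hM' hl hl' hirr]
    · simp [left_eq_of_layered h hM hl' hl hirr']
  subst hL
  rw [List.append_assoc, List.append_assoc, List.append_right_inj] at he
  rcases List.append_eq_append_iff.1 he with ⟨t, rfl, rfl⟩ | ⟨t, rfl, rfl⟩
  · simp [right_eq_of_layered hM hl hirr']
  · simp [right_eq_of_layered hM' hl' hirr]

end Layered

/-- The packed word obtained by packing a nonempty word. -/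
def PackedWord.ofList (x : List ℕ) (hx : x ≠ []) : PackedWord :=
  ⟨pack x, pack_ne_nil.2 hx, isPacked_pack x⟩

/-- Turns the conditions on `m` and `M` into conditions on the letters of the right factor. -/
theorem lastPos_le_iff {a k : ℕ} {x : List ℕ} : lastPos a x ≤ k ↔ a ∉ x.drop k := by
  rw [lastPos, Finset.sup_le_iff]
  constructor
  · intro h ha
    obtain ⟨i, hi, rfl⟩ := List.mem_iff_getElem.1 ha
    rw [List.length_drop] at hi
    have hki : k + i < x.length := by omega
    have := h (k + i + 1) (by simp [List.getElem?_eq_getElem hki]; omega)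
    simp at this
  · intro h i hi
    simp only [Finset.mem_filter, Finset.mem_Icc] at hi
    by_contra hk
    simp only [id, not_le] at hk
    refine h (List.mem_iff_getElem?.2 ⟨i - 1 - k, ?_⟩)
    rw [List.getElem?_drop, show k + (i - 1 - k) = i - 1 by omega, hi.2]

/-- The largest letter of `u` exceeds all letters of `v`. -/
def LeftDominant (u v : List ℕ) : Prop := maxLetter v < maxLetter u

theorem maxLetter_notMem_right_iff {u v : List ℕ} (hv : v ≠ []) :
    maxLetter (u ++ v) ∉ v ↔ LeftDominant u v := by
  rw [LeftDominant, maxLetter_append]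
  constructor
  · intro h
    by_contra! hlt
    rw [max_eq_right hlt] at h
    exact h (maxLetter_mem hv)
  · intro h hmem
    rw [max_eq_left h.le] at hmem
    exact (le_maxLetter hmem).not_gt h

/-- A relation between nonempty words depending only on the relative order of the letters. -/
def OrderInvariant (Q : List ℕ → List ℕ → Prop) : Prop :=
  ∀ (f : ℕ → ℕ) (u v : List ℕ), u ≠ [] → v ≠ [] →
    (∀ a ∈ u ++ v, ∀ b ∈ u ++ v, f a < f b ↔ a < b) → (Q (u.map f) (v.map f) ↔ Q u v)

theorem orderInvariant_leftDominant : OrderInvariant LeftDominant := by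
  intro f u v hu hv hf
  rw [LeftDominant, LeftDominant, maxLetter_lt_iff (by simpa using hu) (by simpa using hv),
    maxLetter_lt_iff hu hv]
  simp only [List.mem_append] at hf
  simp only [List.mem_map, forall_exists_index, and_imp, forall_apply_eq_imp_iff₂,
    exists_exists_and_eq_and]
  grind

theorem OrderInvariant.not {Q : List ℕ → List ℕ → Prop} (hQ : OrderInvariant Q) :
    OrderInvariant fun u v => ¬ Q u v :=
  fun f u v hu hv hf => not_congr (hQ f u v hu hv hf)

theorem orderInvariant_true : OrderInvariant fun _ _ => True := fun _ _ _ _ _ _ => Iff.rfl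

/-- `x` factors into two words with packings `a` and `b` that are related by `Q`. -/
def Splits (Q : List ℕ → List ℕ → Prop) (a b x : List ℕ) : Prop :=
  ∃ u v, x = u ++ v ∧ pack u = a ∧ pack v = b ∧ Q u v

/-! ### Factorizations with prescribed packings -/

section SplitLemmas

variable {Q : List ℕ → List ℕ → Prop} {a b x : List ℕ}

theorem splits_iff_left : Splits Q a b x ↔ (pack (x.take a.length) = a ∧
    Q (x.take a.length) (x.drop a.length)) ∧ pack (x.drop a.length) = b := by
  constructor
  · rintro ⟨u, v, rfl, rfl, rfl, h⟩
    simp [length_pack, h]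
  · rintro ⟨⟨h1, h2⟩, h3⟩
    exact ⟨_, _, (List.take_append_drop a.length x).symm, h1, h3, h2⟩

theorem splits_iff_right : Splits Q a b x ↔ (pack (x.drop (x.length - b.length)) = b ∧
    Q (x.take (x.length - b.length)) (x.drop (x.length - b.length))) ∧
      pack (x.take (x.length - b.length)) = a := by
  constructor
  · rintro ⟨u, v, rfl, rfl, rfl, h⟩
    simp [length_pack, h]
  · rintro ⟨⟨h1, h2⟩, h3⟩
    exact ⟨_, _, (List.take_append_drop (x.length - b.length) x).symm, h3, h1, h2⟩

/-- Packing is strictly increasing on the letters of `x`, so it preserves the packings of factors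
and every order-invariant relation between them. -/
theorem splits_pack (hQ : OrderInvariant Q) (ha : a ≠ []) (hb : b ≠ []) :
    Splits Q a b (pack x) ↔ Splits Q a b x := by
  constructor
  · rintro ⟨u', v', he, rfl, rfl, h⟩
    rw [pack_eq_map, List.map_eq_append_iff] at he
    obtain ⟨u, v, rfl, rfl, rfl⟩ := he
    refine ⟨u, v, rfl, ?_, ?_, ?_⟩
    · rw [pack_map_letterRank (by simp +contextual)]
    · rw [pack_map_letterRank (by simp +contextual)]
    · rwa [hQ _ u v (by simpa [pack_ne_nil] using ha) (by simpa [pack_ne_nil] using hb)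
        fun a _ b hb => letterRank_lt_iff hb] at h
  · rintro ⟨u, v, rfl, rfl, rfl, h⟩
    refine ⟨_, _, by rw [pack_eq_map, List.map_append], ?_, ?_, ?_⟩
    · rw [pack_map_letterRank (by simp +contextual)]
    · rw [pack_map_letterRank (by simp +contextual)]
    · rwa [hQ _ u v (pack_ne_nil.1 ha) (pack_ne_nil.1 hb)
        fun a _ b hb => letterRank_lt_iff hb]

end SplitLemmas

/-! ### Products as sums over factorizations, and the dendriform axioms -/

namespace WQSymPlus

open Finsupp

variable (K : Type u) [Field K]

open scoped Classical in
theorem product_single_single (C : ℕ → PackedWord → Prop) (a b x : PackedWord) :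
    product K C (single a 1) (single b 1) x =
      if x ∈ convolutionSet a b ∧ C a.1.length x then 1 else 0 := by
  simp [product, Finsupp.finsetSum_apply, Finsupp.single_apply, convolution]

/-- The product of packed words defined by a relation `Q` between the two factors of a word. -/
noncomputable def splitProduct (Q : List ℕ → List ℕ → Prop) :
    WQSymPlus K →ₗ[K] WQSymPlus K →ₗ[K] WQSymPlus K :=
  product K fun k x => Q (x.1.take k) (x.1.drop k)

open scoped Classical in
theorem splitProduct_single_single (Q : List ℕ → List ℕ → Prop) (a b x : PackedWord) :
    splitProduct K Q (single a 1) (single b 1) x = if Splits Q a.1 b.1 x.1 then 1 else 0 := by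
  rw [splitProduct, product_single_single]
  refine if_congr ?_ rfl rfl
  rw [splits_iff_left]
  simp only [convolutionSet, Set.mem_ofPred_eq]
  constructor
  · tauto
  · rintro ⟨⟨h1, h2⟩, h3⟩
    refine ⟨⟨?_, h1, h3⟩, h2⟩
    have e1 := congrArg List.length h1
    have e3 := congrArg List.length h3
    simp only [length_pack, List.length_take, List.length_drop] at e1 e3
    omega

variable {K}

theorem bilin_ext {p q : WQSymPlus K →ₗ[K] WQSymPlus K →ₗ[K] WQSymPlus K}
    (h : ∀ a b x, p (single a 1) (single b 1) x = q (single a 1) (single b 1) x) : p = q := by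
  refine Finsupp.lhom_ext' fun a => LinearMap.ext_ring (Finsupp.lhom_ext' fun b =>
    LinearMap.ext_ring (Finsupp.ext fun x => ?_))
  simpa using h a b x

variable (K)

/-- Summing over both cases for `m` leaves `M ≤ k`, which says that the maximum of the word does not
occur in the right factor. -/
theorem left_eq : left K = splitProduct K LeftDominant := by
  classical
  refine bilin_ext fun a b x => ?_
  rw [left, LinearMap.add_apply, LinearMap.add_apply, Finsupp.add_apply, nw, sw,
    product_single_single, product_single_single, splitProduct, product_single_single]
  by_cases h : x ∈ convolutionSet a b
  · have h1 : x.M ≤ a.1.length ↔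
        LeftDominant (x.1.take a.1.length) (x.1.drop a.1.length) := by
      rw [PackedWord.M, lastPos_le_iff, ← maxLetter_notMem_right_iff, List.take_append_drop]
      rw [← pack_ne_nil, h.2.2]
      exact b.2.1
    simp only [h, true_and, ← h1, ← not_le]
    by_cases h2 : x.M ≤ a.1.length <;> by_cases h3 : x.m ≤ a.1.length <;> simp [h2, h3]
  · simp [h]

theorem left_add_right : left K + right K = splitProduct K fun _ _ => True := by
  classical
  refine bilin_ext fun a b x => ?_
  simp only [left, right, LinearMap.add_apply, Finsupp.add_apply, nw, sw, ne, se,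
    product_single_single, splitProduct, ← not_le]
  by_cases h1 : x ∈ convolutionSet a b <;> by_cases h2 : x.M ≤ a.1.length <;>
    by_cases h3 : x.m ≤ a.1.length <;> simp [h1, h2, h3]

theorem right_eq : right K = splitProduct K fun u v => ¬ LeftDominant u v := by
  classical
  refine bilin_ext fun a b x => ?_
  have h0 := congrArg (fun q => q (single a 1) (single b 1) x) (left_add_right K)
  simp only [left_eq, LinearMap.add_apply, Finsupp.add_apply] at h0
  rw [← add_right_inj, h0]
  simp only [splitProduct, product_single_single]
  by_cases h : LeftDominant (x.1.take a.1.length) (x.1.drop a.1.length) <;> simp [h]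

variable {K}

/-- The coefficient of the packing of a word. -/
noncomputable def packCoeff (f : WQSymPlus K) (x : List ℕ) : K :=
  open scoped Classical in if h : x ≠ [] then f (PackedWord.ofList x h) else 0

open scoped Classical in
theorem packCoeff_single (a : PackedWord) (x : List ℕ) :
    packCoeff (single a (1 : K)) x = if pack x = a.1 then 1 else 0 := by
  by_cases h : x ≠ []
  · simp [packCoeff, h, PackedWord.ofList, Finsupp.single_apply, Subtype.ext_iff, eq_comm]
  · have : pack x ≠ a.1 := fun h' => h (pack_ne_nil.1 (h' ▸ a.2.1))
    simp [packCoeff, h, this]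

theorem packCoeff_add (f g : WQSymPlus K) (x : List ℕ) :
    packCoeff (f + g) x = packCoeff f x + packCoeff g x := by
  by_cases h : x ≠ [] <;> simp [packCoeff, h]

theorem packCoeff_smul (k : K) (f : WQSymPlus K) (x : List ℕ) :
    packCoeff (k • f) x = k * packCoeff f x := by
  by_cases h : x ≠ [] <;> simp [packCoeff, h]

theorem packCoeff_zero (x : List ℕ) : packCoeff (0 : WQSymPlus K) x = 0 := by
  by_cases h : x ≠ [] <;> simp [packCoeff, h]

open scoped Classical in
theorem packCoeff_splitProduct {Q : List ℕ → List ℕ → Prop} (hQ : OrderInvariant Q)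
    (a b : PackedWord) (x : List ℕ) :
    packCoeff (splitProduct K Q (single a 1) (single b 1)) x =
      if Splits Q a.1 b.1 x then 1 else 0 := by
  by_cases h : x ≠ []
  · simp only [packCoeff, h, dif_pos, splitProduct_single_single, PackedWord.ofList,
      splits_pack hQ a.2.1 b.2.1, ne_eq, not_false_eq_true]
  · have : ¬ Splits Q a.1 b.1 x := by
      rintro ⟨u, v, rfl, hu, hv, -⟩
      have := pack_ne_nil.1 (hu ▸ a.2.1)
      simp [this] at h
    simp [packCoeff, h, this]

-- The suffix of `x` is not packed in general; its packing is the only basis word of `g` that can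
-- contribute. Since `g` is arbitrary, iterated products can be computed.
open scoped Classical in
theorem splitProduct_single_left (Q : List ℕ → List ℕ → Prop) (a : PackedWord)
    (g : WQSymPlus K) (x : PackedWord) :
    splitProduct K Q (single a 1) g x =
      if pack (x.1.take a.1.length) = a.1 ∧ Q (x.1.take a.1.length) (x.1.drop a.1.length)
      then packCoeff g (x.1.drop a.1.length) else 0 := by
  induction g using Finsupp.induction_linear with
  | zero => simp [packCoeff_zero]
  | add f g hf hg =>
    rw [map_add, Finsupp.add_apply, hf, hg, packCoeff_add]
    split_ifs <;> simp
  | single b k =>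
    rw [single_eq_smul_single b k, map_smul, Finsupp.smul_apply, splitProduct_single_single,
      packCoeff_smul, packCoeff_single, splits_iff_left]
    split_ifs <;> simp_all

open scoped Classical in
theorem splitProduct_single_right (Q : List ℕ → List ℕ → Prop) (b : PackedWord)
    (g : WQSymPlus K) (x : PackedWord) :
    splitProduct K Q g (single b 1) x =
      if pack (x.1.drop (x.1.length - b.1.length)) = b.1 ∧
        Q (x.1.take (x.1.length - b.1.length)) (x.1.drop (x.1.length - b.1.length))
      then packCoeff g (x.1.take (x.1.length - b.1.length)) else 0 := by
  induction g using Finsupp.induction_linear with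
  | zero => simp [packCoeff_zero]
  | add f g hf hg =>
    rw [map_add, LinearMap.add_apply, Finsupp.add_apply, hf, hg, packCoeff_add]
    split_ifs <;> simp
  | single a k =>
    rw [single_eq_smul_single a k, map_smul, LinearMap.smul_apply, Finsupp.smul_apply,
      splitProduct_single_single, packCoeff_smul, packCoeff_single, splits_iff_right]
    split_ifs <;> simp_all

open scoped Classical in
theorem splitProduct_splitProduct_right (Q : List ℕ → List ℕ → Prop)
    {Q' : List ℕ → List ℕ → Prop} (hQ' : OrderInvariant Q') (a b c x : PackedWord) :
    splitProduct K Q (single a 1) (splitProduct K Q' (single b 1) (single c 1)) x =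
      if ∃ u v t, x.1 = u ++ v ++ t ∧ pack u = a.1 ∧ pack v = b.1 ∧ pack t = c.1 ∧
        Q' v t ∧ Q u (v ++ t) then 1 else 0 := by
  rw [splitProduct_single_left, packCoeff_splitProduct hQ', ← ite_and]
  refine if_congr ⟨?_, ?_⟩ rfl rfl
  · rintro ⟨⟨h1, h2⟩, v, t, h3, h4, h5, h6⟩
    refine ⟨_, v, t, ?_, h1, h4, h5, h6, h3 ▸ h2⟩
    rw [List.append_assoc, ← h3, List.take_append_drop]
  · rintro ⟨u, v, t, h1, h2, h3, h4, h5, h6⟩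
    have hu : a.1.length = u.length := by rw [← h2, length_pack]
    rw [h1, hu, List.append_assoc, List.take_left, List.drop_left]
    exact ⟨⟨h2, h6⟩, v, t, rfl, h3, h4, h5⟩

open scoped Classical in
theorem splitProduct_splitProduct_left (Q : List ℕ → List ℕ → Prop)
    {Q' : List ℕ → List ℕ → Prop} (hQ' : OrderInvariant Q') (a b c x : PackedWord) :
    splitProduct K Q (splitProduct K Q' (single a 1) (single b 1)) (single c 1) x =
      if ∃ u v t, x.1 = u ++ v ++ t ∧ pack u = a.1 ∧ pack v = b.1 ∧ pack t = c.1 ∧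
        Q' u v ∧ Q (u ++ v) t then 1 else 0 := by
  rw [splitProduct_single_right, packCoeff_splitProduct hQ', ← ite_and]
  refine if_congr ⟨?_, ?_⟩ rfl rfl
  · rintro ⟨⟨h1, h2⟩, u, v, h3, h4, h5, h6⟩
    refine ⟨u, v, _, ?_, h4, h5, h1, h6, h3 ▸ h2⟩
    rw [← h3, List.take_append_drop]
  · rintro ⟨u, v, t, h1, h2, h3, h4, h5, h6⟩
    have hu : x.1.length - c.1.length = (u ++ v).length := by
      rw [h1, ← h4, length_pack, List.length_append, Nat.add_sub_cancel]
    rw [hu, h1, List.take_left, List.drop_left]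
    exact ⟨⟨h4, h6⟩, u, v, rfl, h2, h3, h5⟩

/-- Both sides are sums over words cut into three factors with the same packings, so it suffices
that the selection conditions agree on each cut. -/
theorem splitProduct_assoc {Q₁ Q₂ Q₃ Q₄ : List ℕ → List ℕ → Prop}
    (h₂ : OrderInvariant Q₂) (h₄ : OrderInvariant Q₄)
    (h : ∀ u v t, u ≠ [] → v ≠ [] → t ≠ [] → (Q₂ u v ∧ Q₁ (u ++ v) t ↔ Q₄ v t ∧ Q₃ u (v ++ t)))
    (x y z : WQSymPlus K) :
    splitProduct K Q₁ (splitProduct K Q₂ x y) z = splitProduct K Q₃ x (splitProduct K Q₄ y z) := by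
  classical
  induction x using Finsupp.induction_linear with
  | zero => simp
  | add f g hf hg => simp only [map_add, LinearMap.add_apply, hf, hg]
  | single a k =>
    rw [single_eq_smul_single a k]
    simp only [map_smul, LinearMap.smul_apply]
    congr 1
    induction y using Finsupp.induction_linear with
    | zero => simp
    | add f g hf hg => simp only [map_add, LinearMap.add_apply, hf, hg]
    | single b k =>
      rw [single_eq_smul_single b k]
      simp only [map_smul, LinearMap.smul_apply]
      congr 1
      induction z using Finsupp.induction_linear with
      | zero => simp
      | add f g hf hg => simp only [map_add, hf, hg]
      | single c k =>
        rw [single_eq_smul_single c k]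
        simp only [map_smul]
        congr 1
        refine Finsupp.ext fun x => ?_
        rw [splitProduct_splitProduct_left Q₁ h₂, splitProduct_splitProduct_right Q₃ h₄]
        refine if_congr (exists_congr fun u => exists_congr fun v => exists_congr fun t =>
          and_congr_right fun _ => and_congr_right fun h1 => and_congr_right fun h2 =>
          and_congr_right fun h3 => h u v t ?_ ?_ ?_) rfl rfl
        · exact pack_ne_nil.1 (h1 ▸ a.2.1)
        · exact pack_ne_nil.1 (h2 ▸ b.2.1)
        · exact pack_ne_nil.1 (h3 ▸ c.2.1)

variable (K)

/-- With `← + →` the unrestricted product, each axiom says on a cut `u v t` that the last occurrence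
of the maximum lies in `u`, `v` or `t` respectively. -/
theorem isDendriform_left_right : IsDendriform (left K) (right K) := by
  have hadd : ∀ x y : WQSymPlus K,
      left K x y + right K x y = splitProduct K (fun _ _ => True) x y := by
    intro x y
    rw [← left_add_right]
    rfl
  constructor
  · intro x y z
    rw [hadd, left_eq]
    refine splitProduct_assoc orderInvariant_leftDominant orderInvariant_true ?_ x y z
    intro u v t _ _ _
    simp only [LeftDominant, maxLetter_append, true_and, max_lt_iff, lt_max_iff]
    omega
  · intro x y z
    rw [right_eq, left_eq]
    refine splitProduct_assoc orderInvariant_leftDominant.not orderInvariant_leftDominant ?_ x y z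
    intro u v t _ _ _
    simp only [LeftDominant, maxLetter_append, max_lt_iff, lt_max_iff]
    omega
  · intro x y z
    rw [hadd, right_eq]
    refine splitProduct_assoc orderInvariant_true orderInvariant_leftDominant.not ?_ x y z
    intro u v t _ _ _
    simp only [LeftDominant, maxLetter_append, true_and, max_lt_iff, lt_max_iff]
    omega

end WQSymPlus

/-- The word underlying an optional packed word, `none` standing for the empty word. -/
def optWord (o : Option PackedWord) : List ℕ := o.elim [] Subtype.val

theorem optWord_injective : Function.Injective optWord := by
  rintro (_ | a) (_ | b) h
  · rfl
  · exact absurd h.symm b.2.1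
  · exact absurd h a.2.1
  · exact congrArg some (Subtype.ext h)

theorem exists_optWord_eq_pack (x : List ℕ) : ∃ o, pack x = optWord o := by
  by_cases hx : x = []
  · exact ⟨none, by rw [hx]; rfl⟩
  · exact ⟨some (PackedWord.ofList x hx), rfl⟩

theorem pos_of_mem_optWord {o : Option PackedWord} {a : ℕ} (ha : a ∈ optWord o) : 1 ≤ a := by
  cases o with
  | none => simp [optWord] at ha
  | some b => exact IsPacked.pos b.2.2 ha

theorem pack_eq_nil {x : List ℕ} : pack x = [] ↔ x = [] := not_iff_not.1 pack_ne_nil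

/-- `x` is a layered word with blocks of packings `l`, `m` and `r`. -/
def IsLayeredProduct (l : Option PackedWord) (m : PackedWord) (r : Option PackedWord)
    (x : PackedWord) : Prop :=
  ∃ L M R, x.1 = L ++ M ++ R ∧ pack L = optWord l ∧ pack M = m.1 ∧ pack R = optWord r ∧
    Layered L M R

theorem exists_isLayeredProduct (l : Option PackedWord) (m : PackedWord) (r : Option PackedWord) :
    ∃ x, IsLayeredProduct l m r x := by
  obtain ⟨L, M, R, h, hL, hM, hR⟩ := exists_layered (optWord l) m.1 (optWord r) m.2.1
    (fun a => IsPacked.pos m.2.2) (fun a => pos_of_mem_optWord)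
  have hpack : ∀ o, pack (optWord o) = optWord o := by
    rintro (_ | a)
    · rfl
    · exact IsPacked.pack_eq a.2.2
  have hM0 : M ≠ [] := by
    rw [← pack_ne_nil, hM, pack_ne_nil]
    exact m.2.1
  refine ⟨PackedWord.ofList (L ++ M ++ R) (by simp [hM0]), _, _, _,
    (pack_eq_map _).trans (by rw [List.map_append, List.map_append]), ?_, ?_, ?_,
    (layered_map_iff fun a _ b hb => letterRank_lt_iff hb).2 h⟩
  · rw [pack_map_letterRank (by simp +contextual), hL, hpack]
  · rw [pack_map_letterRank (by simp +contextual), hM, IsPacked.pack_eq m.2.2]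
  · rw [pack_map_letterRank (by simp +contextual), hR, hpack]

/-- The layered word with prescribed packings of its blocks. -/
noncomputable def layeredWord (l : Option PackedWord) (m : PackedWord) (r : Option PackedWord) :
    PackedWord := (exists_isLayeredProduct l m r).choose

theorem isLayeredProduct_layeredWord (l : Option PackedWord) (m : PackedWord)
    (r : Option PackedWord) : IsLayeredProduct l m r (layeredWord l m r) :=
  (exists_isLayeredProduct l m r).choose_spec

/-- A packed word equals its packing, which `Layered.pack_eq` determines from the packed blocks. -/
theorem IsLayeredProduct.eq_layeredWord {l : Option PackedWord} {m : PackedWord}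
    {r : Option PackedWord} {x : PackedWord} (h : IsLayeredProduct l m r x) :
    x = layeredWord l m r := by
  obtain ⟨L, M, R, hx, hL, hM, hR, hl⟩ := h
  obtain ⟨L', M', R', hx', hL', hM', hR', hl'⟩ := isLayeredProduct_layeredWord l m r
  refine Subtype.ext ?_
  rw [← IsPacked.pack_eq x.2.2, ← IsPacked.pack_eq (layeredWord l m r).2.2, hx, hx']
  exact hl.pack_eq hl' (hL.trans hL'.symm) (hM.trans hM'.symm) (hR.trans hR'.symm)

theorem length_layeredWord (l : Option PackedWord) (m : PackedWord) (r : Option PackedWord) :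
    (layeredWord l m r).1.length = (optWord l).length + m.1.length + (optWord r).length := by
  obtain ⟨L, M, R, hx, hL, hM, hR, -⟩ := isLayeredProduct_layeredWord l m r
  rw [hx, ← hL, ← hM, ← hR]
  simp [length_pack, add_assoc]

/-- Irreducibility is invariant under packing, so the unique factorization of words passes to packed
blocks. -/
theorem layeredWord_bijective : Function.Bijective
    fun t : Option PackedWord × {x : PackedWord | LayerIrreducible x.1} × Option PackedWord =>
      layeredWord t.1 t.2.1 t.2.2 := by
  constructor
  · rintro ⟨l, ⟨m, hm⟩, r⟩ ⟨l', ⟨m', hm'⟩, r'⟩ he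
    obtain ⟨L, M, R, hx, hL, hM, hR, hl⟩ := isLayeredProduct_layeredWord l m r
    obtain ⟨L', M', R', hx', hL', hM', hR', hl'⟩ := isLayeredProduct_layeredWord l' m' r'
    simp only at he
    rw [he, hx'] at hx
    obtain ⟨rfl, rfl, rfl⟩ := layered_unique hx (pack_ne_nil.1 (hM' ▸ m'.2.1))
      (pack_ne_nil.1 (hM ▸ m.2.1)) hl' hl
      (layerIrreducible_pack.1 (hM'.symm ▸ hm')) (layerIrreducible_pack.1 (hM.symm ▸ hm))
    obtain rfl := optWord_injective (hL.symm.trans hL')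
    obtain rfl := optWord_injective (hR.symm.trans hR')
    obtain rfl := Subtype.ext (hM.symm.trans hM')
    rfl
  · intro x
    obtain ⟨L, M, R, hx, hM, hl, hirr⟩ := exists_layerIrreducible x.1 x.2.1
    obtain ⟨l, hL⟩ := exists_optWord_eq_pack L
    obtain ⟨r, hR⟩ := exists_optWord_eq_pack R
    refine ⟨⟨l, ⟨PackedWord.ofList M hM, layerIrreducible_pack.2 hirr⟩, r⟩, ?_⟩
    exact (IsLayeredProduct.eq_layeredWord ⟨L, M, R, hx, hL, rfl, hR, hl⟩).symm

/-! ### Unitriangularity and freeness for `←` and `→` -/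

namespace WQSymPlus

open Finsupp

variable (K : Type u) [Field K]

open scoped Classical in
theorem tripleProd_left_right_apply (l : Option PackedWord) (m : PackedWord)
    (r : Option PackedWord) (x : PackedWord) :
    tripleProd (left K) (right K) l m r x =
      if ∃ L M R, x.1 = L ++ M ++ R ∧ pack L = optWord l ∧ pack M = m.1 ∧ pack R = optWord r ∧
        (R ≠ [] → LeftDominant M R) ∧ (L ≠ [] → ¬ LeftDominant L (M ++ R)) then 1 else 0 := by
  have hne : ∀ {y : List ℕ} {a : PackedWord}, pack y = a.1 → y ≠ [] :=
    fun {y a} h => pack_ne_nil.1 (h ▸ a.2.1)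
  cases l with
  | none =>
    cases r with
    | none =>
      simp only [tripleProd, succOpt, precOpt, Option.map_none, Option.elim_none,
        Finsupp.single_apply, optWord]
      refine if_congr ⟨?_, ?_⟩ rfl rfl
      · rintro rfl
        exact ⟨[], m.1, [], by simp, rfl, IsPacked.pack_eq m.2.2, rfl, by simp, by simp⟩
      · rintro ⟨L, M, R, h1, h2, h3, h4, -⟩
        rw [pack_eq_nil.1 h2, pack_eq_nil.1 h4] at h1
        refine Subtype.ext ?_
        rw [← h3, ← IsPacked.pack_eq x.2.2, h1]
        simp
    | some r =>
      simp only [tripleProd, succOpt, precOpt, Option.map_none, Option.elim_none, Option.map_some,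
        Option.elim_some, optWord, left_eq, splitProduct_single_single]
      refine if_congr ⟨?_, ?_⟩ rfl rfl
      · rintro ⟨M, R, h1, h2, h3, h4⟩
        exact ⟨[], M, R, h1, rfl, h2, h3, fun _ => h4, by simp⟩
      · rintro ⟨L, M, R, h1, h2, h3, h4, h5, -⟩
        rw [pack_eq_nil.1 h2] at h1
        exact ⟨M, R, h1, h3, h4, h5 (hne h4)⟩
  | some l =>
    cases r with
    | none =>
      simp only [tripleProd, succOpt, precOpt, Option.map_none, Option.elim_none, Option.map_some,
        Option.elim_some, optWord, right_eq, splitProduct_single_single]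
      refine if_congr ⟨?_, ?_⟩ rfl rfl
      · rintro ⟨L, M, h1, h2, h3, h4⟩
        exact ⟨L, M, [], by simpa using h1, h2, h3, rfl, by simp, fun _ => by simpa using h4⟩
      · rintro ⟨L, M, R, h1, h2, h3, h4, -, h5⟩
        obtain rfl := pack_eq_nil.1 h4
        rw [List.append_nil] at h1 h5
        exact ⟨L, M, h1, h2, h3, h5 (hne h2)⟩
    | some r =>
      simp only [tripleProd, succOpt, precOpt, Option.map_some, Option.elim_some, optWord,
        right_eq, left_eq, splitProduct_splitProduct_right _ orderInvariant_leftDominant]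
      refine if_congr (exists_congr fun L => exists_congr fun M => exists_congr fun R =>
        and_congr_right fun _ => and_congr_right fun h1 => and_congr_right fun _ =>
        and_congr_right fun h3 => ?_) rfl rfl
      simp [hne h1, hne h3]

/-- The layered word occurs with coefficient 1; any other word that occurs has `max R < max M`
without being layered, hence fewer ascents. -/
theorem tripleProd_triangular (l : Option PackedWord) (m : PackedWord) (r : Option PackedWord) :
    ∀ x ∈ (tripleProd (left K) (right K) l m r - single (layeredWord l m r) 1).support,
      x.1.length = (layeredWord l m r).1.length ∧
        ascents x.1 < ascents (layeredWord l m r).1 := by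
  classical
  intro x hx
  rw [Finsupp.mem_support_iff, Finsupp.sub_apply, tripleProd_left_right_apply] at hx
  obtain ⟨L', M', R', hx', hL', hM', hR', hl'⟩ := isLayeredProduct_layeredWord l m r
  have hM0 : M' ≠ [] := pack_ne_nil.1 (hM' ▸ m.2.1)
  by_cases hxe : x = layeredWord l m r
  · subst hxe
    refine absurd ?_ hx
    rw [if_pos, Finsupp.single_eq_same, sub_self]
    refine ⟨L', M', R', hx', hL', hM', hR', fun hR0 => ?_, fun hL0 => ?_⟩
    · exact (maxLetter_lt_iff hM0 hR0).2 hl'.right_lt_max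
    · have := hl'.left_lt_mid _ (maxLetter_mem hL0) _ (maxLetter_mem hM0)
      simp only [LeftDominant, maxLetter_append, max_lt_iff]
      omega
  · rw [Finsupp.single_eq_of_ne hxe, sub_zero] at hx
    split_ifs at hx with h
    · obtain ⟨L, M, R, h1, hL, hM, hR, hdom, -⟩ := h
      constructor
      · rw [h1, length_layeredWord, ← hL, ← hM, ← hR]
        simp [length_pack, add_assoc]
      · have := hl'.ascents_lt_or (hL.trans hL'.symm) (hM.trans hM'.symm) (hR.trans hR'.symm) ?_
        · rw [h1, hx']
          refine this.resolve_right fun hl => hxe ?_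
          exact IsLayeredProduct.eq_layeredWord ⟨L, M, R, h1, hL, hM, hR, hl⟩
        · intro c hc
          have hR0 : R ≠ [] := List.ne_nil_of_mem hc
          exact (maxLetter_lt_iff (pack_ne_nil.1 (hM ▸ m.2.1)) hR0).1 (hdom hR0) c hc
    · exact absurd rfl hx

/-- The generators are the irreducible packed words, graded by length and ordered within a length by
ascents. -/
theorem isFreeDendriform_left_right : IsFreeDendriform.{u, u, w} (left K) (right K) := by
  have hpos : ∀ m : PackedWord, 0 < m.1.length := fun m => List.length_pos_iff.2 m.2.1
  refine ⟨isDendriform_left_right K, _, isFreeDendriformOn_of_triangular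
    (isDendriform_left_right K) (fun x => x.1.length) (fun x => ascents x.1)
    (Equiv.ofBijective _ layeredWord_bijective) ?_ ?_ ?_⟩
  · intro l m r
    have := hpos m.1
    simp only [Equiv.ofBijective_apply, length_layeredWord, optWord, Option.elim_some]
    omega
  · intro l m r
    have := hpos m.1
    simp only [Equiv.ofBijective_apply, length_layeredWord, optWord, Option.elim_some]
    omega
  · intro l m r
    exact tripleProd_triangular K l m r

end WQSymPlus

/-! ### Complement of packed words: exchanging `m` and `M` -/

section Complement

/-- The word obtained by reversing the order of the letters `1, …, max(x)`. -/
def complementWord (x : List ℕ) : List ℕ := x.map (maxLetter x + 1 - ·)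

theorem IsPacked.maxLetter_complementWord_and {x : List ℕ} (hx : IsPacked x) :
    IsPacked (complementWord x) ∧ maxLetter (complementWord x) = maxLetter x := by
  have h1 : (complementWord x).toFinset = Finset.Icc 1 (maxLetter x) := by
    have : (complementWord x).toFinset = x.toFinset.image (maxLetter x + 1 - ·) := by
      ext a; simp [complementWord]
    rw [this, hx]
    ext a
    simp only [Finset.mem_image, Finset.mem_Icc]
    constructor
    · rintro ⟨b, hb, rfl⟩
      omega
    · intro ha
      exact ⟨maxLetter x + 1 - a, by omega, by omega⟩
  have h2 : maxLetter (complementWord x) = maxLetter x := by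
    conv_rhs => rw [maxLetter, hx]
    rw [maxLetter, h1]
  exact ⟨by rw [IsPacked, h1, h2], h2⟩

theorem IsPacked.complementWord_complementWord {x : List ℕ} (hx : IsPacked x) :
    complementWord (complementWord x) = x := by
  conv_lhs => rw [complementWord, hx.maxLetter_complementWord_and.2, complementWord, List.map_map]
  conv_rhs => rw [← List.map_id x]
  refine List.map_congr_left fun a ha => ?_
  have := le_maxLetter ha
  simp only [Function.comp, id]
  omega

/-- Both words reverse the order of the letters of `x`, so they are order equivalent, and the
complement is already packed. -/
theorem pack_map_of_anti {x : List ℕ} {f : ℕ → ℕ} (hf : ∀ a ∈ x, ∀ b ∈ x, f a < f b ↔ b < a) :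
    pack (x.map f) = complementWord (pack x) := by
  rw [← IsPacked.pack_eq (isPacked_pack x).maxLetter_complementWord_and.1]
  have : OrderEquivalent (x.map fun a => (f a, maxLetter (pack x) + 1 - letterRank x a)) := by
    intro p hp q hq
    obtain ⟨a, ha, rfl⟩ := List.mem_map.1 hp
    obtain ⟨b, hb, rfl⟩ := List.mem_map.1 hq
    have h1 : letterRank x a ≤ maxLetter (pack x) := le_maxLetter (List.mem_map_of_mem ha)
    have h2 : letterRank x b ≤ maxLetter (pack x) := le_maxLetter (List.mem_map_of_mem hb)
    simp only
    rw [hf a ha b hb, ← letterRank_lt_iff ha]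
    omega
  have := this.pack_eq
  simpa [Function.comp_def, complementWord, pack_eq_map x] using this

/-- The involution of packed words that reverses the order of the letters. -/
def complementEquiv : PackedWord ≃ PackedWord :=
  Function.Involutive.toPerm
    (fun x => ⟨complementWord x.1, by simpa [complementWord] using x.2.1,
      (IsPacked.maxLetter_complementWord_and x.2.2).1⟩)
    fun x => Subtype.ext (IsPacked.complementWord_complementWord x.2.2)

theorem coe_complementEquiv (x : PackedWord) : (complementEquiv x).1 = complementWord x.1 := rfl

theorem complementEquiv_complementEquiv (x : PackedWord) :
    complementEquiv (complementEquiv x) = x :=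
  Subtype.ext (IsPacked.complementWord_complementWord x.2.2)

theorem length_complementEquiv (x : PackedWord) : (complementEquiv x).1.length = x.1.length := by
  simp [coe_complementEquiv, complementWord]

theorem complementEquiv_mem_convolutionSet {a b x : PackedWord} (h : x ∈ convolutionSet a b) :
    complementEquiv x ∈ convolutionSet (complementEquiv a) (complementEquiv b) := by
  obtain ⟨h1, h2, h3⟩ := h
  have anti : ∀ a ∈ x.1, ∀ b ∈ x.1,
      maxLetter x.1 + 1 - a < maxLetter x.1 + 1 - b ↔ b < a := by
    intro a ha b hb
    have := le_maxLetter ha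
    have := le_maxLetter hb
    omega
  refine ⟨by simp only [length_complementEquiv, h1], ?_, ?_⟩
  · rw [length_complementEquiv, coe_complementEquiv, coe_complementEquiv,
      complementWord, ← List.map_take, pack_map_of_anti, h2]
    exact fun a ha b hb => anti a (List.mem_of_mem_take ha) b (List.mem_of_mem_take hb)
  · rw [length_complementEquiv, coe_complementEquiv, coe_complementEquiv,
      complementWord, ← List.map_drop, pack_map_of_anti, h3]
    exact fun a ha b hb => anti a (List.mem_of_mem_drop ha) b (List.mem_of_mem_drop hb)

theorem complementEquiv_mem_convolutionSet_iff {a b x : PackedWord} :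
    complementEquiv x ∈ convolutionSet (complementEquiv a) (complementEquiv b) ↔
      x ∈ convolutionSet a b := by
  refine ⟨fun h => ?_, complementEquiv_mem_convolutionSet⟩
  simpa only [complementEquiv_complementEquiv] using complementEquiv_mem_convolutionSet h

/-- The complement has a 1 exactly where `x` has its maximum; this turns the conditions defining
`←`, `→` into those defining `↑`, `↓`. -/
theorem m_complementEquiv_le_iff (x : PackedWord) (k : ℕ) :
    (complementEquiv x).m ≤ k ↔ x.M ≤ k := by
  rw [PackedWord.m, PackedWord.M, lastPos_le_iff, lastPos_le_iff, coe_complementEquiv,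
    complementWord, ← List.map_drop, List.mem_map, not_iff_not]
  have hle : ∀ a ∈ x.1.drop k, a ≤ maxLetter x.1 :=
    fun a ha => le_maxLetter (List.mem_of_mem_drop ha)
  constructor
  · rintro ⟨a, ha, h⟩
    have := hle a ha
    rwa [show maxLetter x.1 = a by omega]
  · exact fun h => ⟨_, h, by omega⟩

end Complement

namespace WQSymPlus

open Finsupp

variable (K : Type u) [Field K]

/-- The linear involution induced by the complement of packed words. -/
noncomputable def complement : WQSymPlus K ≃ₗ[K] WQSymPlus K :=
  Finsupp.domLCongr complementEquiv

open scoped Classical in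
theorem left_single_single (a b x : PackedWord) : left K (single a 1) (single b 1) x =
    if x ∈ convolutionSet a b ∧ x.M ≤ a.1.length then 1 else 0 := by
  simp only [left, LinearMap.add_apply, Finsupp.add_apply, nw, sw, product_single_single, ← not_le]
  by_cases h1 : x ∈ convolutionSet a b <;> by_cases h2 : x.M ≤ a.1.length <;>
    by_cases h3 : x.m ≤ a.1.length <;> simp [h1, h2, h3]

open scoped Classical in
theorem right_single_single (a b x : PackedWord) : right K (single a 1) (single b 1) x =
    if x ∈ convolutionSet a b ∧ ¬ x.M ≤ a.1.length then 1 else 0 := by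
  simp only [right, LinearMap.add_apply, Finsupp.add_apply, ne, se, product_single_single, ← not_le]
  by_cases h1 : x ∈ convolutionSet a b <;> by_cases h2 : x.M ≤ a.1.length <;>
    by_cases h3 : x.m ≤ a.1.length <;> simp [h1, h2, h3]

open scoped Classical in
theorem up_single_single (a b x : PackedWord) : up K (single a 1) (single b 1) x =
    if x ∈ convolutionSet a b ∧ x.m ≤ a.1.length then 1 else 0 := by
  simp only [up, LinearMap.add_apply, Finsupp.add_apply, nw, ne, product_single_single, ← not_le]
  by_cases h1 : x ∈ convolutionSet a b <;> by_cases h2 : x.M ≤ a.1.length <;>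
    by_cases h3 : x.m ≤ a.1.length <;> simp [h1, h2, h3]

open scoped Classical in
theorem down_single_single (a b x : PackedWord) : down K (single a 1) (single b 1) x =
    if x ∈ convolutionSet a b ∧ ¬ x.m ≤ a.1.length then 1 else 0 := by
  simp only [down, LinearMap.add_apply, Finsupp.add_apply, sw, se, product_single_single, ← not_le]
  by_cases h1 : x ∈ convolutionSet a b <;> by_cases h2 : x.M ≤ a.1.length <;>
    by_cases h3 : x.m ≤ a.1.length <;> simp [h1, h2, h3]

variable {K}

theorem complement_mul {p q : WQSymPlus K →ₗ[K] WQSymPlus K →ₗ[K] WQSymPlus K}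
    (h : ∀ a b x, q (single (complementEquiv a) 1) (single (complementEquiv b) 1)
      (complementEquiv x) = p (single a 1) (single b 1) x) (x y : WQSymPlus K) :
    q (complement K x) (complement K y) = complement K (p x y) := by
  have : q.compl₁₂ (complement K).toLinearMap (complement K).toLinearMap =
      p.compr₂ (complement K).toLinearMap := by
    refine bilin_ext fun a b x => ?_
    obtain ⟨x, rfl⟩ := complementEquiv.surjective x
    have := h a b x
    simpa [complement, Finsupp.domLCongr_apply, Finsupp.domCongr_apply] using this
  exact congrArg (fun f => f x y) this

theorem up_complement (x y : WQSymPlus K) :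
    up K (complement K x) (complement K y) = complement K (left K x y) := by
  classical
  refine complement_mul (fun a b x => ?_) x y
  rw [up_single_single, left_single_single, length_complementEquiv]
  simp only [complementEquiv_mem_convolutionSet_iff, m_complementEquiv_le_iff]

theorem down_complement (x y : WQSymPlus K) :
    down K (complement K x) (complement K y) = complement K (right K x y) := by
  classical
  refine complement_mul (fun a b x => ?_) x y
  rw [down_single_single, right_single_single, length_complementEquiv]
  simp only [complementEquiv_mem_convolutionSet_iff, m_complementEquiv_le_iff]

end WQSymPlus

theorem mainTheorem10 (K : Type u) [Field K] :
    IsFreeDendriform.{u, u, w} (WQSymPlus.left K) (WQSymPlus.right K) ∧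
      IsFreeDendriform.{u, u, w} (WQSymPlus.up K) (WQSymPlus.down K) :=
  ⟨WQSymPlus.isFreeDendriform_left_right K,
    (WQSymPlus.isFreeDendriform_left_right K).of_equiv (WQSymPlus.complement K)
      WQSymPlus.up_complement WQSymPlus.down_complement⟩
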